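/- Let $\mathbb{K}$ be $\mathbb{R}$ or $\mathbb{C}$, let $m \ge 1$, and let $\mathrm{Aff}(m) := GL(m,\mathbb{R}) \ltimes \mathbb{R}^m$ be the affine group, with product $(K,s)(L,t) = (KL, s+Kt)$. A unitary representation of a topological group $G$ on a nonzero Hilbert space $H$ is a strongly continuous homomorphism from $G$ to the group of unitary operators of $H$ (orthogonal operators, if the scalars are real); it is called irreducible if the only closed subspaces of $H$ that are invariant under $G$ are $\{0\}$ and $H$. Let $\pi$ be the unitary representation of $G := O(m) \times \mathrm{Aff}(m)$ on $L^2(\mathbb{R}^m;\mathbb{K}^m)$ defined by $$\pi_g[f](x) := |\det L|^{-1/2}\, Q\, f(L^{-1}(x-t)), \qquad x \in \mathbb{R}^m,\ g = (Q,L,t) \in O(m) \times (GL(m,\mathbb{R}) \ltimes \mathbb{R}^m).$$ Then $\pi$ is irreducible; in particular this holds for $L^2(\mathbb{R}^m;\mathbb{R}^m)$. Moreover, $\pi$ is the outer tensor product of the standard representation $Q \cdot y := Qy$ of $O(m)$ on $\mathbb{K}^m$ and the regular representation $\big((L,t)\cdot f\big)(x) := |\det L|^{-1/2} f(L^{-1}(x-t))$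 of $\mathrm{Aff}(m)$ on $L^2(\mathbb{R}^m;\mathbb{K})$: there is a unitary operator $U : \mathbb{K}^m \otimes L^2(\mathbb{R}^m;\mathbb{K}) \to L^2(\mathbb{R}^m;\mathbb{K}^m)$ with $U(y \otimes f)(x) = f(x)\,y$ for almost every $x$, which intertwines this outer tensor product with $\pi$. -/

import Mathlib

open MeasureTheory
open scoped TensorProduct

noncomputable section

/-- A (strongly continuous) unitary representation of a topological group `G` on the Hilbert space
`H` over `𝕜`. -/
structure UnitaryRep (𝕜 : Type*) [RCLike 𝕜] (G : Type*) [Group G] [TopologicalSpace G]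
    (H : Type*) [NormedAddCommGroup H] [InnerProductSpace 𝕜 H] [CompleteSpace H] where
  /-- The homomorphism into the group of unitary operators of `H`. -/
  toHom : G →* (H ≃ₗᵢ[𝕜] H)
  /-- Continuity for the strong operator topology. -/
  continuous_orbit : ∀ ψ : H, Continuous fun g : G => toHom g ψ

namespace UnitaryRep

/-- A unitary representation on `H` is irreducible if `H` is nonzero and the only closed subspaces
of `H` that are invariant under all the operators of the representation are `0` and `H`. -/
def IsIrreducible {𝕜 : Type*} [RCLike 𝕜] {G : Type*} [Group G] [TopologicalSpace G]
    {H : Type*} [NormedAddCommGroup H] [InnerProductSpace 𝕜 H] [CompleteSpace H]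
    (π : UnitaryRep 𝕜 G H) : Prop :=
  Nontrivial H ∧ ∀ M : Submodule 𝕜 H, IsClosed (M : Set H) →
    (∀ g : G, ∀ ψ ∈ M, π.toHom g ψ ∈ M) → M = ⊥ ∨ M = ⊤

/-- The unitary operator `U` intertwines `π₁` and `π₂`, so that it is a unitary equivalence of these
representations of `G`. -/
def Intertwines {𝕜 : Type*} [RCLike 𝕜] {G : Type*} [Group G] [TopologicalSpace G]
    {H₁ : Type*} [NormedAddCommGroup H₁] [InnerProductSpace 𝕜 H₁] [CompleteSpace H₁]
    {H₂ : Type*} [NormedAddCommGroup H₂] [InnerProductSpace 𝕜 H₂] [CompleteSpace H₂]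
    (U : H₁ ≃ₗᵢ[𝕜] H₂) (π₁ : UnitaryRep 𝕜 G H₁) (π₂ : UnitaryRep 𝕜 G H₂) : Prop :=
  ∀ (g : G) (ψ : H₁), U (π₁.toHom g ψ) = π₂.toHom g (U ψ)

/-- To check strong continuity of a family of linear isometries it suffices to do it on a
dense subset. -/
theorem continuous_orbit_of_dense {𝕜 : Type*} [RCLike 𝕜] {G : Type*} [TopologicalSpace G]
    {H : Type*} [NormedAddCommGroup H] [InnerProductSpace 𝕜 H] (T : G → H →ₗᵢ[𝕜] H)
    {D : Set H} (hD : Dense D) (h : ∀ ψ ∈ D, Continuous fun g => T g ψ) (ψ : H) :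
    Continuous fun g => T g ψ := by
  refine continuous_of_uniform_approx_of_continuous fun u hu => ?_
  obtain ⟨ε, hε, hεu⟩ := Metric.mem_uniformity_dist.1 hu
  obtain ⟨d, hd, hdist⟩ := Metric.dense_iff.1 hD ψ ε hε
  refine ⟨fun g => T g d, h d hdist, fun g => hεu ?_⟩
  rw [(T g).isometry.dist_eq, dist_comm]
  exact hd

/-- A strongly continuous multiplicative family of linear isometries is a unitary
representation. -/
def ofIsometries {𝕜 : Type*} [RCLike 𝕜] {G : Type*} [Group G] [TopologicalSpace G]
    {H : Type*} [NormedAddCommGroup H] [InnerProductSpace 𝕜 H] [CompleteSpace H]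
    (T : G → H →ₗᵢ[𝕜] H)
    (one : ∀ ψ, T 1 ψ = ψ) (mul : ∀ g h ψ, T (g * h) ψ = T g (T h ψ))
    (cont : ∀ ψ, Continuous fun g => T g ψ) : UnitaryRep 𝕜 G H where
  toHom :=
    { toFun := fun g =>
        { (T g) with
          invFun := T g⁻¹
          left_inv := fun ψ => by
            change T g⁻¹ (T g ψ) = ψ
            rw [← mul, inv_mul_cancel, one]
          right_inv := fun ψ => by
            change T g (T g⁻¹ ψ) = ψ
            rw [← mul, mul_inv_cancel, one] }
      map_one' := by
        ext ψ
        exact one ψ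
      map_mul' := fun g h => by
        ext ψ
        exact mul g h ψ }
  continuous_orbit := cont

end UnitaryRep

/-! ### Outer tensor products -/

/-- The extension of a unitary operator of a pre-Hilbert space to the completion. -/
def completionMap {𝕜 : Type*} [RCLike 𝕜] {E : Type*} [NormedAddCommGroup E]
    [InnerProductSpace 𝕜 E] (u : E ≃ₗᵢ[𝕜] E) :
    UniformSpace.Completion E →ₗᵢ[𝕜] UniformSpace.Completion E where
  toFun := UniformSpace.Completion.map u
  map_add' x y := by
    have hc := u.isometry.uniformContinuous
    refine UniformSpace.Completion.induction_on₂ x y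
      (isClosed_eq (UniformSpace.Completion.continuous_map.comp continuous_add)
        (Continuous.add
          (f := fun p : UniformSpace.Completion E × UniformSpace.Completion E =>
            UniformSpace.Completion.map u p.1)
          (g := fun p => UniformSpace.Completion.map u p.2)
          (UniformSpace.Completion.continuous_map.comp continuous_fst)
          (UniformSpace.Completion.continuous_map.comp continuous_snd))) fun a b => ?_
    rw [← UniformSpace.Completion.coe_add, UniformSpace.Completion.map_coe hc,
      UniformSpace.Completion.map_coe hc, UniformSpace.Completion.map_coe hc, map_add,
      UniformSpace.Completion.coe_add]
  map_smul' c x := by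
    have hc := u.isometry.uniformContinuous
    have h1 : Continuous fun x => c • UniformSpace.Completion.map u x :=
      (continuous_const_smul c).comp UniformSpace.Completion.continuous_map
    refine UniformSpace.Completion.induction_on x
      (isClosed_eq (UniformSpace.Completion.continuous_map.comp (continuous_const_smul c)) h1)
      fun a => ?_
    rw [← UniformSpace.Completion.coe_smul, UniformSpace.Completion.map_coe hc,
      UniformSpace.Completion.map_coe hc, map_smul, UniformSpace.Completion.coe_smul,
      RingHom.id_apply]
  norm_map' x := by
    have hc := u.isometry.uniformContinuous
    refine UniformSpace.Completion.induction_on x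
      (isClosed_eq (UniformSpace.Completion.continuous_map.norm) continuous_norm) fun a => ?_
    change ‖UniformSpace.Completion.map u (a : UniformSpace.Completion E)‖ = _
    rw [UniformSpace.Completion.map_coe hc, UniformSpace.Completion.norm_coe,
      UniformSpace.Completion.norm_coe, LinearIsometryEquiv.norm_map]

theorem completionMap_coe {𝕜 : Type*} [RCLike 𝕜] {E : Type*} [NormedAddCommGroup E]
    [InnerProductSpace 𝕜 E] (u : E ≃ₗᵢ[𝕜] E) (x : E) :
    completionMap u (x : UniformSpace.Completion E) = ((u x : E) : UniformSpace.Completion E) :=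
  UniformSpace.Completion.map_coe u.isometry.uniformContinuous x

/-- The Hilbert space tensor product: the completion of the algebraic tensor product with respect
to the inner product `⟪x₁ ⊗ x₂, y₁ ⊗ y₂⟫ = ⟪x₁, y₁⟫ ⟪x₂, y₂⟫`. -/
abbrev HilbertTensor (𝕜 : Type*) [RCLike 𝕜]
    (H₁ : Type*) [NormedAddCommGroup H₁] [InnerProductSpace 𝕜 H₁]
    (H₂ : Type*) [NormedAddCommGroup H₂] [InnerProductSpace 𝕜 H₂] : Type _ :=
  UniformSpace.Completion (H₁ ⊗[𝕜] H₂)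

namespace HilbertTensor

variable {𝕜 : Type*} [RCLike 𝕜]
  {H₁ : Type*} [NormedAddCommGroup H₁] [InnerProductSpace 𝕜 H₁]
  {H₂ : Type*} [NormedAddCommGroup H₂] [InnerProductSpace 𝕜 H₂]

/-- The elementary tensor `x ⊗ y` in the Hilbert space tensor product. -/
def tmul (x : H₁) (y : H₂) : HilbertTensor 𝕜 H₁ H₂ :=
  ((x ⊗ₜ[𝕜] y : H₁ ⊗[𝕜] H₂) : HilbertTensor 𝕜 H₁ H₂)

/-- The tensor product of two unitary operators, as an isometry of the Hilbert space tensor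
product. -/
def map (u : H₁ ≃ₗᵢ[𝕜] H₁) (v : H₂ ≃ₗᵢ[𝕜] H₂) :
    HilbertTensor 𝕜 H₁ H₂ →ₗᵢ[𝕜] HilbertTensor 𝕜 H₁ H₂ :=
  completionMap (TensorProduct.congrIsometry u v)

theorem map_coe (u : H₁ ≃ₗᵢ[𝕜] H₁) (v : H₂ ≃ₗᵢ[𝕜] H₂) (x : H₁ ⊗[𝕜] H₂) :
    map u v (x : HilbertTensor 𝕜 H₁ H₂) =
      ((TensorProduct.congrIsometry u v x : H₁ ⊗[𝕜] H₂) : HilbertTensor 𝕜 H₁ H₂) :=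
  completionMap_coe _ x

theorem map_tmul (u : H₁ ≃ₗᵢ[𝕜] H₁) (v : H₂ ≃ₗᵢ[𝕜] H₂) (x : H₁) (y : H₂) :
    map u v (tmul x y) = tmul (𝕜 := 𝕜) (u x) (v y) :=
  map_coe u v _

end HilbertTensor

/-- The outer tensor product `π₁ ⊗ π₂` of unitary representations of `G₁` and `G₂`, a unitary
representation of `G₁ × G₂` on the Hilbert space tensor product with
`(g₁, g₂) (x ⊗ y) = (g₁ x) ⊗ (g₂ y)`. -/
def UnitaryRep.outerTensor {𝕜 : Type*} [RCLike 𝕜]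
    {G₁ : Type*} [Group G₁] [TopologicalSpace G₁] {G₂ : Type*} [Group G₂] [TopologicalSpace G₂]
    {H₁ : Type*} [NormedAddCommGroup H₁] [InnerProductSpace 𝕜 H₁] [CompleteSpace H₁]
    {H₂ : Type*} [NormedAddCommGroup H₂] [InnerProductSpace 𝕜 H₂] [CompleteSpace H₂]
    (π₁ : UnitaryRep 𝕜 G₁ H₁) (π₂ : UnitaryRep 𝕜 G₂ H₂) :
    UnitaryRep 𝕜 (G₁ × G₂) (HilbertTensor 𝕜 H₁ H₂) :=
  UnitaryRep.ofIsometries (fun g => HilbertTensor.map (π₁.toHom g.1) (π₂.toHom g.2))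
    (fun ψ => by
      refine UniformSpace.Completion.induction_on ψ
        (isClosed_eq (LinearIsometry.continuous _) continuous_id) fun a => ?_
      rw [HilbertTensor.map_coe]
      congr 1
      induction a with
      | zero => simp
      | tmul x y =>
        change (π₁.toHom 1 x) ⊗ₜ[𝕜] (π₂.toHom 1 y) = _
        rw [map_one, map_one]
        rfl
      | add x y hx hy => rw [map_add, hx, hy])
    (fun g h ψ => by
      refine UniformSpace.Completion.induction_on ψ
        (isClosed_eq (LinearIsometry.continuous _)
          ((LinearIsometry.continuous _).comp (LinearIsometry.continuous _))) fun a => ?_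
      rw [HilbertTensor.map_coe, HilbertTensor.map_coe, HilbertTensor.map_coe]
      congr 1
      induction a with
      | zero => simp
      | tmul x y =>
        change (π₁.toHom (g.1 * h.1) x) ⊗ₜ[𝕜] (π₂.toHom (g.2 * h.2) y) = _
        rw [map_mul, map_mul]
        rfl
      | add x y hx hy => rw [map_add, hx, hy, map_add, map_add])
    (fun ψ => by
      refine UnitaryRep.continuous_orbit_of_dense _
        (D := Set.range ((↑) : H₁ ⊗[𝕜] H₂ → HilbertTensor 𝕜 H₁ H₂))
        UniformSpace.Completion.denseRange_coe ?_ ψ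
      rintro _ ⟨a, rfl⟩
      simp only [HilbertTensor.map_coe]
      refine (UniformSpace.Completion.continuous_coe _).comp ?_
      induction a with
      | zero => simpa using continuous_const
      | tmul x y =>
        have h := TensorProduct.continuous_tmul (𝕜 := 𝕜) (E := H₁) (F := H₂)
        exact h.comp (((π₁.continuous_orbit x).comp continuous_fst).prodMk
          ((π₂.continuous_orbit y).comp continuous_snd))
      | add x y hx hy =>
        simp only [map_add]
        exact hx.add hy)

/-! ### The affine group -/

/-- The action of `GL(m)` on the (additive) group `ℝ^m` by automorphisms. -/
def glAut (m : ℕ) :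
    GL (Fin m) ℝ →* MulAut (Multiplicative (EuclideanSpace ℝ (Fin m))) where
  toFun L :=
    { toFun := fun t => Multiplicative.ofAdd (Matrix.toEuclideanLin L.1 t.toAdd)
      invFun := fun t => Multiplicative.ofAdd (Matrix.toEuclideanLin L⁻¹.1 t.toAdd)
      left_inv := fun t => by
        simp [Matrix.toLpLin_apply]
      right_inv := fun t => by
        simp [Matrix.toLpLin_apply]
      map_mul' := fun s t => by simp }
  map_one' := by
    ext t
    simp
  map_mul' K L := by
    ext t
    simp [Matrix.toLpLin_apply]

/-- The affine group `Aff(m) = GL(m) ⋉ ℝ^m`, with `(K, s) (L, t) = (K L, s + K t)`. -/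
def Aff (m : ℕ) : Type :=
  Multiplicative (EuclideanSpace ℝ (Fin m)) ⋊[glAut m] GL (Fin m) ℝ

namespace Aff

variable {m : ℕ}

instance : Group (Aff m) :=
  inferInstanceAs (Group (Multiplicative (EuclideanSpace ℝ (Fin m)) ⋊[glAut m] GL (Fin m) ℝ))

/-- The linear part `L` of `(L, t)`. -/
def lin (g : Aff m) : GL (Fin m) ℝ := SemidirectProduct.right g

/-- The translation part `t` of `(L, t)`. -/
def trans (g : Aff m) : EuclideanSpace ℝ (Fin m) := (SemidirectProduct.left g).toAdd

/-- The element `(L, t)`. -/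
def mk (L : GL (Fin m) ℝ) (t : EuclideanSpace ℝ (Fin m)) : Aff m :=
  ⟨Multiplicative.ofAdd t, L⟩

/-- The topology of `GL(m) × ℝ^m`. -/
instance : TopologicalSpace (Aff m) :=
  TopologicalSpace.induced (fun g => (g.lin, g.trans)) inferInstance

theorem continuous_lin : Continuous (lin : Aff m → GL (Fin m) ℝ) :=
  continuous_fst.comp (continuous_induced_dom (f := fun g : Aff m => (g.lin, g.trans)))

theorem continuous_trans : Continuous (trans : Aff m → EuclideanSpace ℝ (Fin m)) :=
  continuous_snd.comp (continuous_induced_dom (f := fun g : Aff m => (g.lin, g.trans)))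

@[simp] theorem lin_one : (1 : Aff m).lin = 1 := rfl
@[simp] theorem trans_one : (1 : Aff m).trans = 0 := rfl
@[simp] theorem lin_mul (g h : Aff m) : (g * h).lin = g.lin * h.lin := rfl
@[simp] theorem trans_mul (g h : Aff m) :
    (g * h).trans = g.trans + Matrix.toEuclideanLin g.lin.1 h.trans := rfl
@[simp] theorem lin_inv (g : Aff m) : (g⁻¹).lin = g.lin⁻¹ := rfl
@[simp] theorem trans_inv (g : Aff m) :
    (g⁻¹).trans = Matrix.toEuclideanLin (g.lin⁻¹).1 (-g.trans) := rfl

instance : IsTopologicalGroup (Aff m) where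
  continuous_mul := by
    have h1 := Aff.continuous_lin (m := m)
    have h2 := Aff.continuous_trans (m := m)
    refine continuous_induced_rng.2 (Continuous.prodMk
      ((h1.comp continuous_fst).mul (h1.comp continuous_snd))
      (Continuous.add (h2.comp continuous_fst) ?_))
    exact (PiLp.continuous_toLp 2 (fun _ : Fin m => ℝ)).comp (Continuous.matrix_mulVec
      (Units.continuous_val.comp (h1.comp continuous_fst))
      ((PiLp.continuous_ofLp 2 (fun _ : Fin m => ℝ)).comp (h2.comp continuous_snd)))
  continuous_inv := by
    have h1 := Aff.continuous_lin (m := m)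
    have h2 := Aff.continuous_trans (m := m)
    refine continuous_induced_rng.2 (Continuous.prodMk h1.inv ?_)
    exact (PiLp.continuous_toLp 2 (fun _ : Fin m => ℝ)).comp (Continuous.matrix_mulVec
      (Units.continuous_val.comp h1.inv)
      ((PiLp.continuous_ofLp 2 (fun _ : Fin m => ℝ)).comp h2.neg))

end Aff

/-! ### The regular representations -/

namespace AffRep

variable {𝕜 : Type*} [RCLike 𝕜] {m : ℕ}
  {Y : Type*} [NormedAddCommGroup Y] [InnerProductSpace 𝕜 Y]

/-- The change of variables `x ↦ L⁻¹ (x - t)`. -/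
def pull (g : Aff m) (x : EuclideanSpace ℝ (Fin m)) : EuclideanSpace ℝ (Fin m) :=
  Matrix.toEuclideanLin (g.lin⁻¹).1 (x - g.trans)

/-- The function `x ↦ |det L|^(-1/2) u (f (L⁻¹ (x - t)))`. -/
def twist (u : Y ≃ₗᵢ[𝕜] Y) (g : Aff m) (f : EuclideanSpace ℝ (Fin m) → Y) :
    EuclideanSpace ℝ (Fin m) → Y :=
  fun x => ((|g.lin.1.det| ^ (-(1 / 2) : ℝ) : ℝ) : 𝕜) • u (f (pull g x))

theorem det_ne_zero (g : Aff m) : g.lin.1.det ≠ 0 :=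
  ((Matrix.isUnit_iff_isUnit_det _).1 g.lin.isUnit).ne_zero

theorem continuous_pull_uncurry :
    Continuous fun p : Aff m × EuclideanSpace ℝ (Fin m) => pull p.1 p.2 := by
  have h1 : Continuous fun p : Aff m × EuclideanSpace ℝ (Fin m) => (p.1.lin⁻¹).1 :=
    Units.continuous_val.comp ((Aff.continuous_lin.comp continuous_fst).inv)
  have h2 : Continuous fun p : Aff m × EuclideanSpace ℝ (Fin m) => p.2 - p.1.trans :=
    continuous_snd.sub (Aff.continuous_trans.comp continuous_fst)
  have h3 : Continuous fun p : Aff m × EuclideanSpace ℝ (Fin m) =>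
      Matrix.mulVec (p.1.lin⁻¹).1 (WithLp.ofLp (p.2 - p.1.trans)) :=
    Continuous.matrix_mulVec h1 ((PiLp.continuous_ofLp 2 (fun _ : Fin m => ℝ)).comp h2)
  have h4 : (fun p : Aff m × EuclideanSpace ℝ (Fin m) => pull p.1 p.2) = fun p =>
      WithLp.toLp 2 (Matrix.mulVec (p.1.lin⁻¹).1 (WithLp.ofLp (p.2 - p.1.trans))) := by
    funext p
    rw [pull, Matrix.toLpLin_apply]
  rw [h4]
  exact (PiLp.continuous_toLp 2 (fun _ : Fin m => ℝ)).comp h3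

theorem continuous_pull (g : Aff m) : Continuous (pull g) :=
  Continuous.comp (g := fun p : Aff m × EuclideanSpace ℝ (Fin m) => pull p.1 p.2)
    (f := fun x => (g, x)) continuous_pull_uncurry (Continuous.prodMk_right g)

theorem pull_one (x : EuclideanSpace ℝ (Fin m)) : pull 1 x = x := by
  simp [pull]

theorem pull_mul (g h : Aff m) (x : EuclideanSpace ℝ (Fin m)) :
    pull (g * h) x = pull h (pull g x) := by
  have : (((g.lin * h.lin)⁻¹ : GL (Fin m) ℝ)).1 = (h.lin⁻¹).1 * (g.lin⁻¹).1 := by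
    rw [mul_inv_rev]; rfl
  simp only [pull, Aff.lin_mul, this, Aff.trans_mul]
  ext i
  simp [Matrix.toLpLin_apply, Matrix.mulVec_sub, Matrix.mulVec_add,
    sub_sub, -Matrix.coe_units_inv]

theorem map_pull (g : Aff m) :
    Measure.map (pull g) (volume : Measure (EuclideanSpace ℝ (Fin m))) =
      ENNReal.ofReal |g.lin.1.det| • volume := by
  have hdet : LinearMap.det (Matrix.toEuclideanLin (g.lin⁻¹).1) = (g.lin.1.det)⁻¹ := by
    rw [LinearMap.det_toLpLin]
    simp
  have hne : LinearMap.det (Matrix.toEuclideanLin (g.lin⁻¹).1) ≠ 0 := by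
    rw [hdet]
    exact inv_ne_zero (det_ne_zero g)
  have hc : (pull g) = (Matrix.toEuclideanLin (g.lin⁻¹).1) ∘ fun x => x - g.trans := rfl
  rw [hc, ← Measure.map_map (LinearMap.continuous_of_finiteDimensional _).measurable
    (measurable_sub_const _), map_sub_right_eq_self,
    Measure.map_linearMap_addHaar_eq_smul_addHaar _ hne, hdet, inv_inv]

theorem quasiMeasurePreserving_pull (g : Aff m) :
    Measure.QuasiMeasurePreserving (pull g)
      (volume : Measure (EuclideanSpace ℝ (Fin m))) volume :=
  ⟨(continuous_pull g).measurable, by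
    rw [map_pull]
    exact Measure.smul_absolutelyContinuous⟩

theorem twist_ae_congr (u : Y ≃ₗᵢ[𝕜] Y) (g : Aff m) {f₁ f₂ : EuclideanSpace ℝ (Fin m) → Y}
    (h : f₁ =ᵐ[volume] f₂) : twist u g f₁ =ᵐ[volume] twist u g f₂ := by
  filter_upwards [(quasiMeasurePreserving_pull g).ae_eq h] with x hx
  simp only [Function.comp_apply] at hx
  simp only [twist, hx]

theorem aestronglyMeasurable_twist (u : Y ≃ₗᵢ[𝕜] Y) (g : Aff m)
    {f : EuclideanSpace ℝ (Fin m) → Y} (hf : AEStronglyMeasurable f volume) :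
    AEStronglyMeasurable (twist u g f) volume :=
  (u.continuous.comp_aestronglyMeasurable
    (hf.comp_quasiMeasurePreserving (quasiMeasurePreserving_pull g))).const_smul _

theorem eLpNorm_twist (u : Y ≃ₗᵢ[𝕜] Y) (g : Aff m)
    {f : EuclideanSpace ℝ (Fin m) → Y} (hf : AEStronglyMeasurable f volume) :
    eLpNorm (twist u g f) 2 volume = eLpNorm f 2 volume := by
  have hd : 0 < |g.lin.1.det| := abs_pos.2 (det_ne_zero g)
  have h1 : eLpNorm (twist u g f) 2 volume =
      ENNReal.ofReal (|g.lin.1.det| ^ (-(1 / 2) : ℝ)) * eLpNorm (f ∘ pull g) 2 volume := by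
    have : twist u g f = ((|g.lin.1.det| ^ (-(1 / 2) : ℝ) : ℝ) : 𝕜) • (fun x => u (f (pull g x))) :=
      rfl
    rw [this, eLpNorm_const_smul]
    congr 1
    · rw [← ofReal_norm, RCLike.norm_ofReal, abs_of_nonneg (by positivity)]
    · exact eLpNorm_congr_norm_ae (by simp)
  have h2 : eLpNorm (f ∘ pull g) 2 volume =
      ENNReal.ofReal (|g.lin.1.det| ^ (1 / 2 : ℝ)) * eLpNorm f 2 volume := by
    rw [← eLpNorm_map_measure _ (continuous_pull g).aemeasurable, map_pull,
      eLpNorm_smul_measure_of_ne_top (by simp), smul_eq_mul,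
      ← ENNReal.ofReal_rpow_of_pos hd]
    · norm_num
    · rw [map_pull]
      exact hf.smul_measure _
  rw [h1, h2, ← mul_assoc, ← ENNReal.ofReal_mul (by positivity), ← Real.rpow_add hd]
  norm_num

theorem memLp_twist (u : Y ≃ₗᵢ[𝕜] Y) (g : Aff m)
    {f : EuclideanSpace ℝ (Fin m) → Y} (hf : MemLp f 2 volume) :
    MemLp (twist u g f) 2 volume :=
  ⟨aestronglyMeasurable_twist u g hf.1, by
    rw [eLpNorm_twist u g hf.1]
    exact hf.2⟩

/-- The operator `f ↦ |det L|^(-1/2) u (f (L⁻¹ (x - t)))` on `L²(ℝ^m; Y)`. -/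
def op (u : Y ≃ₗᵢ[𝕜] Y) (g : Aff m) :
    Lp Y 2 (volume : Measure (EuclideanSpace ℝ (Fin m))) →ₗᵢ[𝕜]
      Lp Y 2 (volume : Measure (EuclideanSpace ℝ (Fin m))) where
  toFun f := (memLp_twist u g (Lp.memLp f)).toLp (twist u g f)
  map_add' f₁ f₂ := by
    rw [← MemLp.toLp_add (memLp_twist u g (Lp.memLp f₁)) (memLp_twist u g (Lp.memLp f₂))]
    refine MemLp.toLp_congr _ _ ((twist_ae_congr u g (Lp.coeFn_add f₁ f₂)).trans ?_)
    refine Filter.Eventually.of_forall fun x => ?_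
    simp [twist]
  map_smul' c f := by
    rw [RingHom.id_apply, ← MemLp.toLp_const_smul c (memLp_twist u g (Lp.memLp f))]
    refine MemLp.toLp_congr _ _ ((twist_ae_congr u g (Lp.coeFn_smul c f)).trans ?_)
    refine Filter.Eventually.of_forall fun x => ?_
    simp [twist, smul_comm c]
  norm_map' f := by
    refine (Lp.norm_toLp _ (memLp_twist u g (Lp.memLp f))).trans ?_
    rw [eLpNorm_twist u g (Lp.memLp f).1, Lp.norm_def]

theorem coeFn_op (u : Y ≃ₗᵢ[𝕜] Y) (g : Aff m)
    (f : Lp Y 2 (volume : Measure (EuclideanSpace ℝ (Fin m)))) :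
    op u g f =ᵐ[volume] twist u g f :=
  MemLp.coeFn_toLp (memLp_twist u g (Lp.memLp f))

theorem op_one (f : Lp Y 2 (volume : Measure (EuclideanSpace ℝ (Fin m)))) :
    op (1 : Y ≃ₗᵢ[𝕜] Y) 1 f = f := by
  refine Lp.ext ((coeFn_op _ _ _).trans (Filter.Eventually.of_forall fun x => ?_))
  simp [twist, pull_one]

theorem op_mul (u v : Y ≃ₗᵢ[𝕜] Y) (g h : Aff m)
    (f : Lp Y 2 (volume : Measure (EuclideanSpace ℝ (Fin m)))) :
    op (u * v) (g * h) f = op u g (op v h f) := by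
  refine Lp.ext ((coeFn_op _ _ _).trans ?_)
  refine Filter.EventuallyEq.trans (Filter.Eventually.of_forall fun x => ?_)
    ((coeFn_op _ _ _).trans (twist_ae_congr u g (coeFn_op v h f))).symm
  simp [twist, pull_mul, smul_smul, abs_mul, Real.mul_rpow]

theorem continuous_twist {P : Type*} [TopologicalSpace P] {u : P → Y ≃ₗᵢ[𝕜] Y}
    (hu : ∀ y, Continuous fun p => u p y) {g : P → Aff m} (hg : Continuous g)
    {f : EuclideanSpace ℝ (Fin m) → Y} (hfc : Continuous f) :
    Continuous fun q : P × EuclideanSpace ℝ (Fin m) => twist (u q.1) (g q.1) f q.2 := by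
  have hu2 : Continuous fun q : P × Y => u q.1 q.2 := by
    refine continuous_iff_continuousAt.2 fun q₀ => ?_
    rw [ContinuousAt, tendsto_iff_dist_tendsto_zero]
    have h1 : Continuous fun q : P × Y => dist q.2 q₀.2 + dist (u q.1 q₀.2) (u q₀.1 q₀.2) :=
      (continuous_snd.dist continuous_const).add
        (((hu q₀.2).comp continuous_fst).dist continuous_const)
    refine squeeze_zero (fun _ => dist_nonneg) (fun q => ?_)
      (by simpa using h1.tendsto q₀)
    refine (dist_triangle _ (u q.1 q₀.2) _).trans ?_
    rw [(u q.1).isometry.dist_eq]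
  have hd : Continuous fun a : Aff m => ((|a.lin.1.det| ^ (-(1 / 2) : ℝ) : ℝ) : 𝕜) := by
    have h1 : Continuous fun a : Aff m => a.lin.1.det :=
      Continuous.matrix_det (Units.continuous_val.comp Aff.continuous_lin)
    exact RCLike.continuous_ofReal.comp (h1.abs.rpow_const fun a =>
      Or.inl (abs_pos.2 (det_ne_zero a)).ne')
  have hp : Continuous fun q : P × EuclideanSpace ℝ (Fin m) => pull (g q.1) q.2 :=
    Continuous.comp (g := fun p : Aff m × EuclideanSpace ℝ (Fin m) => pull p.1 p.2)
      (f := fun q : P × EuclideanSpace ℝ (Fin m) => (g q.1, q.2)) continuous_pull_uncurry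
      ((hg.comp continuous_fst).prodMk continuous_snd)
  have h3 : Continuous fun q : P × EuclideanSpace ℝ (Fin m) => u q.1 (f (pull (g q.1) q.2)) :=
    Continuous.comp (g := fun q : P × Y => u q.1 q.2)
      (f := fun q : P × EuclideanSpace ℝ (Fin m) => (q.1, f (pull (g q.1) q.2))) hu2
      (continuous_fst.prodMk (hfc.comp hp))
  have h4 : Continuous fun q : P × EuclideanSpace ℝ (Fin m) =>
      ((|(g q.1).lin.1.det| ^ (-(1 / 2) : ℝ) : ℝ) : 𝕜) := hd.comp (hg.comp continuous_fst)
  exact h4.smul h3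

theorem continuous_op {P : Type*} [TopologicalSpace P] {u : P → Y ≃ₗᵢ[𝕜] Y}
    (hu : ∀ y, Continuous fun p => u p y) {g : P → Aff m} (hg : Continuous g)
    (ψ : Lp Y 2 (volume : Measure (EuclideanSpace ℝ (Fin m)))) :
    Continuous fun p => op (u p) (g p) ψ := by
  refine UnitaryRep.continuous_orbit_of_dense (fun p => op (u p) (g p))
    (D := {ψ | ∃ f : EuclideanSpace ℝ (Fin m) → Y, Continuous f ∧ HasCompactSupport f ∧
      ψ =ᵐ[volume] f}) ?_ ?_ ψ
  · let _ : NormedSpace ℝ Y := NormedSpace.restrictScalars ℝ 𝕜 Y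
    refine Metric.dense_iff.2 fun φ r hr => ?_
    obtain ⟨f, hfs, hfe, hfc, hfm⟩ := (Lp.memLp φ).exists_hasCompactSupport_eLpNorm_sub_le
      (by simp) (ε := ENNReal.ofReal (r / 2)) (by simpa using hr)
    refine ⟨hfm.toLp f, ?_, f, hfc, hfs, hfm.coeFn_toLp⟩
    rw [Metric.mem_ball, dist_comm]
    have h : φ - hfm.toLp f = ((Lp.memLp φ).sub hfm).toLp (⇑φ - f) := by
      rw [MemLp.toLp_sub (Lp.memLp φ) hfm, Lp.toLp_coeFn]
    rw [dist_eq_norm, h, Lp.norm_toLp]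
    exact (ENNReal.toReal_le_of_le_ofReal (by positivity) hfe).trans_lt (by linarith)
  · rintro φ ⟨f, hfc, hfs, hφ⟩
    have hjoint := continuous_twist hu hg hfc
    have hcoe : ∀ p, op (u p) (g p) φ =ᵐ[volume] twist (u p) (g p) f := fun p =>
      (coeFn_op _ _ _).trans (twist_ae_congr _ _ hφ)
    refine continuous_iff_continuousAt.2 fun p₀ => ?_
    have hcs : HasCompactSupport (twist (u p₀) (g p₀) f) := by
      have h1 : HasCompactSupport (f ∘ pull (g p₀)) := by
        have h2 : IsCompact ((pull (g p₀)⁻¹) '' tsupport f) := hfs.image (continuous_pull _)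
        refine HasCompactSupport.intro h2 fun x hx => ?_
        by_contra hne
        refine hx ⟨pull (g p₀) x, subset_tsupport _ hne, ?_⟩
        rw [← pull_mul, mul_inv_cancel, pull_one]
      refine h1.mono' fun x hx => ?_
      refine subset_tsupport _ fun h0 => hx ?_
      simp only [Function.comp_apply] at h0
      simp [twist, h0]
    have hinner : Continuous fun p => inner 𝕜 (op (u p₀) (g p₀) φ) (op (u p) (g p) φ) := by
      have h1 : ∀ p, inner 𝕜 (op (u p₀) (g p₀) φ) (op (u p) (g p) φ) =
          ∫ x, inner 𝕜 (twist (u p₀) (g p₀) f x) (twist (u p) (g p) f x) := fun p => by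
        rw [L2.inner_def]
        refine integral_congr_ae ?_
        filter_upwards [hcoe p₀, hcoe p] with x h1 h2
        rw [h1, h2]
      simp only [h1]
      rw [← continuousOn_univ]
      refine continuousOn_integral_of_compact_support hcs.isCompact ?_ ?_
      · refine Continuous.continuousOn (Continuous.inner ?_ hjoint)
        exact continuous_twist (fun y => continuous_const (y := u p₀ y))
          (continuous_const (y := g p₀)) hfc
      · intro p x _ hx
        rw [image_eq_zero_of_notMem_tsupport hx, inner_zero_left]
    have hsq : ∀ p, dist (op (u p) (g p) φ) (op (u p₀) (g p₀) φ) ^ 2 =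
        2 * ‖φ‖ ^ 2 - 2 * RCLike.re (inner 𝕜 (op (u p₀) (g p₀) φ) (op (u p) (g p) φ)) := fun p => by
      rw [dist_comm, dist_eq_norm, norm_sub_sq (𝕜 := 𝕜), LinearIsometry.norm_map,
        LinearIsometry.norm_map]
      ring
    have hlim : Filter.Tendsto (fun p => dist (op (u p) (g p) φ) (op (u p₀) (g p₀) φ) ^ 2)
        (nhds p₀) (nhds 0) := by
      have h1 : Continuous fun p => dist (op (u p) (g p) φ) (op (u p₀) (g p₀) φ) ^ 2 := by
        simp only [hsq]
        exact continuous_const.sub (continuous_const.mul (RCLike.continuous_re.comp hinner))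
      simpa using h1.tendsto p₀
    rw [ContinuousAt, tendsto_iff_dist_tendsto_zero]
    have h2 := hlim.sqrt
    simpa [Real.sqrt_sq dist_nonneg] using h2

/-- The orthogonal matrix `Q` as the isometry `y ↦ Q y` of `𝕜^m`. -/
def orthogonalIsometry (𝕜 : Type*) [RCLike 𝕜] {m : ℕ}
    (Q : Matrix.orthogonalGroup (Fin m) ℝ) :
    EuclideanSpace 𝕜 (Fin m) →ₗᵢ[𝕜] EuclideanSpace 𝕜 (Fin m) :=
  LinearMap.isometryOfInner (Matrix.toEuclideanLin (Q.1.map (algebraMap ℝ 𝕜))) fun x y => by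
    have h1 : (Q.1.map (algebraMap ℝ 𝕜)).conjTranspose * Q.1.map (algebraMap ℝ 𝕜) = 1 := by
      have h2 : (Q.1.map (algebraMap ℝ 𝕜)).conjTranspose =
          Q.1.transpose.map (algebraMap ℝ 𝕜) := by
        ext i j
        simp
      rw [h2, ← Matrix.map_mul, (Matrix.mem_orthogonalGroup_iff' (Fin m) ℝ).1 Q.2]
      simp
    rw [← LinearMap.adjoint_inner_left, ← Matrix.toEuclideanLin_conjTranspose_eq_adjoint]
    congr 1
    rw [Matrix.toLpLin_apply, Matrix.toLpLin_apply, Matrix.mulVec_mulVec, h1,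
      Matrix.one_mulVec]

theorem orthogonalIsometry_apply (Q : Matrix.orthogonalGroup (Fin m) ℝ)
    (y : EuclideanSpace 𝕜 (Fin m)) :
    orthogonalIsometry 𝕜 Q y = WithLp.toLp 2 ((Q.1.map (algebraMap ℝ 𝕜)).mulVec y.ofLp) :=
  rfl

end AffRep

/-- The standard representation of `O(m)` on `𝕜^m`, `Q • y = Q y`. -/
def stdOrthogonalRep (𝕜 : Type*) [RCLike 𝕜] (m : ℕ) :
    UnitaryRep 𝕜 (Matrix.orthogonalGroup (Fin m) ℝ) (EuclideanSpace 𝕜 (Fin m)) :=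
  UnitaryRep.ofIsometries
    (fun Q => AffRep.orthogonalIsometry 𝕜 Q)
    (fun y => by
      ext i
      simp [AffRep.orthogonalIsometry_apply])
    (fun P Q y => by
      ext i
      simp [AffRep.orthogonalIsometry_apply])
    (fun y => by
      have h1 : Continuous fun Q : Matrix.orthogonalGroup (Fin m) ℝ =>
          (Q.1.map (algebraMap ℝ 𝕜)).mulVec y.ofLp :=
        Continuous.matrix_mulVec
          (Continuous.matrix_map continuous_subtype_val RCLike.continuous_ofReal) continuous_const
      exact (PiLp.continuous_toLp 2 (fun _ : Fin m => 𝕜)).comp h1)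

/-- The regular representation of `Aff(m)` on `L²(ℝ^m; 𝕜)`:
`((L, t) • f) (x) = |det L|^(-1/2) f (L⁻¹ (x - t))`. -/
def affineRegularRep (𝕜 : Type*) [RCLike 𝕜] (m : ℕ) :
    UnitaryRep 𝕜 (Aff m) (Lp 𝕜 2 (volume : Measure (EuclideanSpace ℝ (Fin m)))) :=
  UnitaryRep.ofIsometries (fun g => AffRep.op (1 : 𝕜 ≃ₗᵢ[𝕜] 𝕜) g)
    AffRep.op_one
    (fun g h f => by
      rw [← AffRep.op_mul, one_mul])
    (AffRep.continuous_op (fun _ => continuous_const) continuous_id)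

/-- The representation of `O(m) × Aff(m)` on `L²(ℝ^m; 𝕜^m)`:
`((Q, L, t) • f) (x) = |det L|^(-1/2) Q f (L⁻¹ (x - t))`. -/
def orthogonalAffineRep (𝕜 : Type*) [RCLike 𝕜] (m : ℕ) :
    UnitaryRep 𝕜 (Matrix.orthogonalGroup (Fin m) ℝ × Aff m)
      (Lp (EuclideanSpace 𝕜 (Fin m)) 2 (volume : Measure (EuclideanSpace ℝ (Fin m)))) :=
  UnitaryRep.ofIsometries (fun g => AffRep.op ((stdOrthogonalRep 𝕜 m).toHom g.1) g.2)
    (fun f => by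
      rw [Prod.fst_one, Prod.snd_one, map_one, AffRep.op_one])
    (fun g h f => by
      rw [Prod.fst_mul, Prod.snd_mul, map_mul, AffRep.op_mul])
    (AffRep.continuous_op
      (fun y => ((stdOrthogonalRep 𝕜 m).continuous_orbit y).comp continuous_fst) continuous_snd)

end

/-! Let `M` be a closed invariant subspace, `f` a nonzero element of `M` and `h` orthogonal to `M`.
If `R` is the reflection in the `i`-th coordinate, then `f - R f` is twice the `i`-th component of
`f` times `e_i`. Coordinate swaps move `e_i` to `e_j`, so `M` contains every component `f_i` placed
in any slot `j` (`smulConst_component_mem`). Hence all affine translates of `f_i` are orthogonal to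
`h_j`, and the claim reduces to scalar functions: if all affine translates of `φ` are orthogonal to
`h`, then `φ = 0` or `h = 0`.

For complex scalars this is `eq_zero_or_eq_zero_of_inner_op_complex`. By `fourier_op` and
Plancherel, orthogonality to all translates makes the Fourier transform of an integrable product
vanish, so for each invertible `A` the product of `(𝓕 φ)(A ξ)` and `(𝓕 h)(ξ)` is zero for almost
every `ξ`. By Fubini over the space of matrices, and because `A ↦ A ξ` is onto for `ξ ≠ 0`, one of
the two supports is null (`ae_notMem_or_ae_notMem_of_forall_det_ne_zero`). General scalars embed in
`ℂ`.

For the tensor product, `y ⊗ f ↦ f • y` preserves inner products and is already onto before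
completion, since `𝕜^m` has a finite basis. Its extension to the completion is the required unitary.
-/

section

open scoped FourierTransform SchwartzMap ENNReal

/-! ### Affine changes of variables under the Fourier integral -/

namespace AffRep

variable {m : ℕ}

/-- The affine map `x ↦ L⁻¹ (x - t)` as a homeomorphism. -/
noncomputable def pullHomeomorph (g : Aff m) :
    EuclideanSpace ℝ (Fin m) ≃ₜ EuclideanSpace ℝ (Fin m) where
  toFun := pull g
  invFun := pull g⁻¹
  left_inv x := by rw [← pull_mul, mul_inv_cancel, pull_one]
  right_inv x := by rw [← pull_mul, inv_mul_cancel, pull_one]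
  continuous_toFun := continuous_pull g
  continuous_invFun := continuous_pull g⁻¹

/-- Since `pull g` is a homeomorphism, no measurability or integrability of `F` is needed. -/
theorem integral_comp_pull {E : Type*} [NormedAddCommGroup E] [NormedSpace ℝ E] (g : Aff m)
    (F : EuclideanSpace ℝ (Fin m) → E) :
    ∫ x, F (pull g x) = |g.lin.1.det| • ∫ x, F x := by
  have h := (pullHomeomorph g).measurableEmbedding.integral_map (μ := volume) F
  change ∫ y, F y ∂(Measure.map (pull g) volume) = ∫ x, F (pull g x) at h
  rw [← h, map_pull, integral_smul_measure, ENNReal.toReal_ofReal (abs_nonneg _)]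

theorem toEuclideanLin_pull_add (g : Aff m) (x : EuclideanSpace ℝ (Fin m)) :
    Matrix.toEuclideanLin g.lin.1 (pull g x) + g.trans = x := by
  ext i
  simp [pull, Matrix.toLpLin_apply]

/-- The element `(L⁻ᵀ, 0)`. -/
noncomputable def dual (g : Aff m) : Aff m :=
  Aff.mk ⟨(g.lin⁻¹).1.transpose, g.lin.1.transpose,
    by rw [← Matrix.transpose_mul, Units.mul_inv, Matrix.transpose_one],
    by rw [← Matrix.transpose_mul, Units.inv_mul, Matrix.transpose_one]⟩ 0

theorem pull_dual (g : Aff m) (ξ : EuclideanSpace ℝ (Fin m)) :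
    pull (dual g) ξ = Matrix.toEuclideanLin g.lin.1.transpose ξ := by
  change Matrix.toEuclideanLin g.lin.1.transpose (ξ - 0) = _
  rw [sub_zero]

theorem det_lin_dual (g : Aff m) : (dual g).lin.1.det = (g.lin.1.det)⁻¹ := by
  change (g.lin⁻¹).1.transpose.det = _
  simp

/-- Substitute `x = L w + t`: the translation splits off as a character, and moving `L` across the
inner product puts `Lᵀ` on `ξ`. -/
theorem fourier_twist (g : Aff m) (f : EuclideanSpace ℝ (Fin m) → ℂ)
    (ξ : EuclideanSpace ℝ (Fin m)) :
    𝓕 (twist (1 : ℂ ≃ₗᵢ[ℂ] ℂ) g f) ξ =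
      Real.fourierChar (-inner ℝ g.trans ξ) • twist (1 : ℂ ≃ₗᵢ[ℂ] ℂ) (dual g) (𝓕 f) ξ := by
  have hd : 0 < |g.lin.1.det| := abs_pos.2 (det_ne_zero g)
  have h1 : ∀ v, inner ℝ (Matrix.toEuclideanLin g.lin.1 v) ξ =
      inner ℝ v (pull (dual g) ξ) := fun v => by
    rw [pull_dual, ← LinearMap.adjoint_inner_right, ← Matrix.toEuclideanLin_conjTranspose_eq_adjoint,
      Matrix.conjTranspose_eq_transpose_of_trivial]
  let F : EuclideanSpace ℝ (Fin m) → ℂ := fun w =>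
    Real.fourierChar (-inner ℝ (Matrix.toEuclideanLin g.lin.1 w + g.trans) ξ) •
      ((|g.lin.1.det| ^ (-(1 / 2) : ℝ) : ℝ) : ℂ) • f w
  have h2 : ∀ v, Real.fourierChar (-inner ℝ v ξ) • twist (1 : ℂ ≃ₗᵢ[ℂ] ℂ) g f v =
      F (pull g v) := fun v => by
    simp only [F, toEuclideanLin_pull_add]
    rfl
  rw [Real.fourier_eq, integral_congr_ae (Filter.Eventually.of_forall h2), integral_comp_pull g F]
  have h3 : ∀ w, F w =
      ((Real.fourierChar (-inner ℝ g.trans ξ) : ℂ) * ((|g.lin.1.det| ^ (-(1 / 2) : ℝ) : ℝ) : ℂ)) •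
        (Real.fourierChar (-inner ℝ w (pull (dual g) ξ)) • f w) := fun w => by
    simp only [F]
    rw [inner_add_left, h1, neg_add, AddChar.map_add_eq_mul]
    simp only [Circle.smul_def, Circle.coe_mul, smul_eq_mul]
    ring
  simp only [h3]
  rw [integral_smul, ← Real.fourier_eq]
  -- The Jacobian turns the normalisation of `L` into that of `L⁻ᵀ`.
  have h4 : |g.lin.1.det| * |g.lin.1.det| ^ (-(1 / 2) : ℝ) =
      |(dual g).lin.1.det| ^ (-(1 / 2) : ℝ) := by
    rw [det_lin_dual, abs_inv, Real.inv_rpow hd.le, ← Real.rpow_neg hd.le]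
    nth_rewrite 1 [← Real.rpow_one |g.lin.1.det|]
    rw [← Real.rpow_add hd]
    norm_num
  change _ = Real.fourierChar (-inner ℝ g.trans ξ) •
    ((|(dual g).lin.1.det| ^ (-(1 / 2) : ℝ) : ℝ) : ℂ) • 𝓕 f (pull (dual g) ξ)
  rw [← h4, Complex.real_smul, Circle.smul_def]
  simp only [smul_eq_mul, Complex.ofReal_mul]
  ring

end AffRep

/-! ### The affine action and the Fourier transform on `L²` -/

namespace AffRep

variable {m : ℕ}

theorem hasTemperateGrowth_pull (g : Aff m) : (pull g).HasTemperateGrowth := by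
  change Function.HasTemperateGrowth fun x : EuclideanSpace ℝ (Fin m) =>
    (Matrix.toEuclideanLin (g.lin⁻¹).1).toContinuousLinearMap (x - g.trans)
  fun_prop

/-- The inverse map `x ↦ L x + t` is Lipschitz with constant `‖L‖`. This is what preserves Schwartz
decay under composition with `pull g`. -/
theorem antilipschitzWith_pull (g : Aff m) :
    AntilipschitzWith ‖(Matrix.toEuclideanLin g.lin.1).toContinuousLinearMap‖₊ (pull g) := by
  refine AntilipschitzWith.of_le_mul_dist fun x y => ?_
  nth_rewrite 1 [← toEuclideanLin_pull_add g x, ← toEuclideanLin_pull_add g y]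
  rw [dist_add_right, dist_eq_norm, dist_eq_norm, ← map_sub]
  exact ((Matrix.toEuclideanLin g.lin.1).toContinuousLinearMap).le_opNorm _

/-- The function `x ↦ |det L|^(-1/2) f (L⁻¹ (x - t))` for a Schwartz function `f`. -/
noncomputable def schwartzTwist (g : Aff m) (f : 𝓢(EuclideanSpace ℝ (Fin m), ℂ)) :
    𝓢(EuclideanSpace ℝ (Fin m), ℂ) :=
  ((|g.lin.1.det| ^ (-(1 / 2) : ℝ) : ℝ) : ℂ) • SchwartzMap.compCLMOfAntilipschitz ℂ
    (hasTemperateGrowth_pull g) (antilipschitzWith_pull g) f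

theorem coe_schwartzTwist (g : Aff m) (f : 𝓢(EuclideanSpace ℝ (Fin m), ℂ)) :
    ⇑(schwartzTwist g f) = twist (1 : ℂ ≃ₗᵢ[ℂ] ℂ) g f :=
  rfl

theorem op_toLp (g : Aff m) (f : 𝓢(EuclideanSpace ℝ (Fin m), ℂ)) :
    op (1 : ℂ ≃ₗᵢ[ℂ] ℂ) g (f.toLp 2) = (schwartzTwist g f).toLp 2 := by
  refine Lp.ext ((coeFn_op _ _ _).trans ((twist_ae_congr _ _ (f.coeFn_toLp 2)).trans ?_))
  rw [← coe_schwartzTwist]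
  exact ((schwartzTwist g f).coeFn_toLp 2).symm

theorem memLp_fourierChar_inner (t : EuclideanSpace ℝ (Fin m)) :
    MemLp (fun ξ : EuclideanSpace ℝ (Fin m) => (Real.fourierChar (-inner ℝ t ξ) : ℂ)) ∞ volume := by
  refine memLp_top_of_bound (Continuous.aestronglyMeasurable ?_) 1
    (Filter.Eventually.of_forall fun ξ => (Circle.norm_coe _).le)
  exact continuous_subtype_val.comp (Real.continuous_fourierChar.comp
    (continuous_const.inner continuous_id).neg)

/-- The modulation operator `ψ ↦ (ξ ↦ exp (-2πi ⟪t, ξ⟫) ψ ξ)` on `L²`. -/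
noncomputable def modulation (t : EuclideanSpace ℝ (Fin m)) :
    Lp ℂ 2 (volume : Measure (EuclideanSpace ℝ (Fin m))) →L[ℂ]
      Lp ℂ 2 (volume : Measure (EuclideanSpace ℝ (Fin m))) :=
  (ContinuousLinearMap.mul ℂ ℂ).holderL volume ∞ 2 2 (memLp_fourierChar_inner t).toLp

theorem coeFn_modulation (t : EuclideanSpace ℝ (Fin m))
    (ψ : Lp ℂ 2 (volume : Measure (EuclideanSpace ℝ (Fin m)))) :
    modulation t ψ =ᵐ[volume] fun ξ => (Real.fourierChar (-inner ℝ t ξ) : ℂ) * ψ ξ := by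
  filter_upwards [(ContinuousLinearMap.mul ℂ ℂ).coeFn_holder (r := 2)
    (memLp_fourierChar_inner t).toLp ψ, (memLp_fourierChar_inner t).coeFn_toLp] with ξ h1 h2
  rw [modulation, ContinuousLinearMap.holderL_apply_apply, h1, h2]
  rfl

theorem toLp_fourier_schwartzTwist (g : Aff m) (f : 𝓢(EuclideanSpace ℝ (Fin m), ℂ)) :
    (𝓕 (schwartzTwist g f)).toLp 2 =
      modulation g.trans ((schwartzTwist (dual g) (𝓕 f)).toLp 2) := by
  refine Lp.ext ?_
  filter_upwards [(𝓕 (schwartzTwist g f)).coeFn_toLp 2,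
    (schwartzTwist (dual g) (𝓕 f)).coeFn_toLp 2,
    coeFn_modulation g.trans ((schwartzTwist (dual g) (𝓕 f)).toLp 2)] with ξ h1 h2 h3
  rw [h1, h3, h2, coe_schwartzTwist, SchwartzMap.fourier_coe, SchwartzMap.fourier_coe,
    coe_schwartzTwist, fourier_twist, Circle.smul_def, smul_eq_mul]

/-- The `L²` Fourier transform intertwines the operator of `(L, t)` with that of `(L⁻ᵀ, 0)`,
followed by the modulation with frequency `-t`. -/
theorem fourier_op (g : Aff m) (φ : Lp ℂ 2 (volume : Measure (EuclideanSpace ℝ (Fin m)))) :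
    𝓕 (op (1 : ℂ ≃ₗᵢ[ℂ] ℂ) g φ) =
      modulation g.trans (op (1 : ℂ ≃ₗᵢ[ℂ] ℂ) (dual g) (𝓕 φ)) := by
  have hF : Continuous fun ψ : Lp ℂ 2 (volume : Measure (EuclideanSpace ℝ (Fin m))) => 𝓕 ψ :=
    (Lp.fourierTransformₗᵢ (EuclideanSpace ℝ (Fin m)) ℂ).continuous
  -- Both sides are continuous in `φ`, so the pointwise formula for Schwartz functions is enough.
  refine (SchwartzMap.denseRange_toLpCLM (E := EuclideanSpace ℝ (Fin m)) (F := ℂ) (p := 2)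
    ENNReal.ofNat_ne_top).induction_on φ
    (isClosed_eq (hF.comp (op _ g).continuous)
      ((modulation g.trans).continuous.comp ((op _ (dual g)).continuous.comp hF))) fun f => ?_
  change 𝓕 (op (1 : ℂ ≃ₗᵢ[ℂ] ℂ) g (f.toLp 2)) =
    modulation g.trans (op (1 : ℂ ≃ₗᵢ[ℂ] ℂ) (dual g) (𝓕 (f.toLp 2)))
  rw [op_toLp, SchwartzMap.toLp_fourier_eq, SchwartzMap.toLp_fourier_eq, op_toLp,
    toLp_fourier_schwartzTwist]

end AffRep

/-! ### Uniqueness for the Fourier transform on `L¹` -/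

/-- An integrable function whose Fourier transform vanishes is zero almost everywhere. -/
theorem MeasureTheory.Integrable.ae_eq_zero_of_fourier_eq_zero {V : Type*} [NormedAddCommGroup V]
    [InnerProductSpace ℝ V] [FiniteDimensional ℝ V] [MeasurableSpace V] [BorelSpace V]
    {f : V → ℂ} (hf : Integrable f) (h : ∀ w, 𝓕 f w = 0) : ∀ᵐ x, f x = 0 := by
  refine ae_eq_zero_of_integral_contDiff_smul_eq_zero hf.locallyIntegrable fun g hg hgs => ?_
  have hgs' : HasCompactSupport fun x => (g x : ℂ) := hgs.comp_left (g := Complex.ofReal) rfl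
  have hg' : ContDiff ℝ (⊤ : ℕ∞) fun x => (g x : ℂ) := Complex.ofRealCLM.contDiff.comp hg
  let ψ : 𝓢(V, ℂ) := hgs'.toSchwartzMap hg'
  have h1 : 𝓕 ((𝓕⁻ ψ : 𝓢(V, ℂ)) : V → ℂ) = fun x => (g x : ℂ) := by
    rw [← SchwartzMap.fourier_coe, FourierTransform.fourier_fourierInv_eq]
    rfl
  -- The test function is the transform of the Schwartz function `𝓕⁻ ψ`; the multiplication formula
  -- moves that transform onto `f`, where it vanishes.
  have h2 := VectorFourier.integral_fourierIntegral_smul_eq_flip (L := innerₗ V) (μ := volume)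
    (ν := volume) Real.continuous_fourierChar continuous_inner (𝓕⁻ ψ).integrable hf
  have h3 : ∀ x, VectorFourier.fourierIntegral Real.fourierChar volume (innerₗ V).flip f x = 0 :=
    fun x => by
      rw [flip_innerₗ]
      exact h x
  have h4 : ∀ x, VectorFourier.fourierIntegral Real.fourierChar volume (innerₗ V) (𝓕⁻ ψ : 𝓢(V, ℂ)) x = g x :=
    fun x => congrFun h1 x
  simp only [h3, h4, smul_zero, integral_zero] at h2
  simpa using h2

/-! ### Null sets and the space of matrices -/

/-- On each line `A + s • 1` the determinant is the characteristic polynomial of `-A` at `s`. It is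
monic, so it has finitely many roots, and the lines sweep out the whole space. -/
theorem Matrix.ae_det_ne_zero (m : ℕ) :
    ∀ᵐ A : Fin m → Fin m → ℝ, (Matrix.of A).det ≠ 0 := by
  let ℓ : ℝ →ₗ[ℝ] (Fin m → Fin m → ℝ) :=
    LinearMap.toSpanSingleton ℝ (Fin m → Fin m → ℝ) (1 : Matrix (Fin m) (Fin m) ℝ)
  have hdet : Continuous fun A : Fin m → Fin m → ℝ => (Matrix.of A).det :=
    Continuous.matrix_det (n := Fin m) (R := ℝ) continuous_id
  refine ae_mem_of_ae_add_linearMap_mem ℓ volume volume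
    (s := {A | (Matrix.of A).det ≠ 0}) (isOpen_ne_fun hdet continuous_const).measurableSet
    fun A => ?_
  have h1 : ∀ s : ℝ, (Matrix.of (A + ℓ s)).det = (-Matrix.of A).charpoly.eval s := fun s => by
    rw [Matrix.eval_charpoly]
    congr 1
    ext i j
    change A i j + s * (1 : Matrix (Fin m) (Fin m) ℝ) i j = _
    simp [Matrix.one_apply, Matrix.diagonal_apply, add_comm]
  have h2 : {s : ℝ | (-Matrix.of A).charpoly.IsRoot s}.Finite :=
    Polynomial.finite_setOfPred_isRoot (Matrix.charpoly_monic _).ne_zero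
  filter_upwards [h2.countable.ae_notMem volume] with s hs
  rw [h1]
  exact hs

/-- For every nonzero vector `ξ`, the evaluation `A ↦ A ξ` of matrices is surjective. -/
theorem Matrix.surjective_mulVec {K : Type*} [Field K] {m n : Type*} [Fintype n] [DecidableEq n]
    {ξ : n → K} (hξ : ξ ≠ 0) :
    Function.Surjective fun A : m → n → K => (Matrix.of A).mulVec ξ := by
  obtain ⟨i, hi⟩ := Function.ne_iff.1 hξ
  -- Only column `i`, where `ξ` does not vanish, is used.
  refine fun y => ⟨fun k l => if l = i then y k / ξ i else 0, ?_⟩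
  ext k
  simp only [Matrix.mulVec, dotProduct, Matrix.of_apply, ite_mul, zero_mul]
  rw [Finset.sum_ite_eq' Finset.univ i, if_pos (Finset.mem_univ i), div_mul_cancel₀ _ hi]

/-- If every invertible matrix maps almost no point of `T` to `S`, then `S` or `T` is a
null set. -/
theorem ae_notMem_or_ae_notMem_of_forall_det_ne_zero {m : ℕ} (hm : 1 ≤ m)
    {S T : Set (EuclideanSpace ℝ (Fin m))} (hS : MeasurableSet S) (hT : MeasurableSet T)
    (h : ∀ A : Matrix (Fin m) (Fin m) ℝ, A.det ≠ 0 →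
      ∀ᵐ ξ, ¬ (Matrix.toEuclideanLin A ξ ∈ S ∧ ξ ∈ T)) :
    (∀ᵐ ξ, ξ ∉ S) ∨ ∀ᵐ ξ, ξ ∉ T := by
  -- For `m ≥ 1` the origin, where `A ↦ A ξ` is not onto, is a null set.
  have : Nonempty (Fin m) := ⟨⟨0, hm⟩⟩
  have hcont : Continuous fun p : (Fin m → Fin m → ℝ) × EuclideanSpace ℝ (Fin m) =>
      Matrix.toEuclideanLin (Matrix.of p.1) p.2 :=
    (PiLp.continuous_toLp 2 (fun _ : Fin m => ℝ)).comp (Continuous.matrix_mulVec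
      (A := fun p : (Fin m → Fin m → ℝ) × EuclideanSpace ℝ (Fin m) => Matrix.of p.1)
      continuous_fst ((PiLp.continuous_ofLp 2 (fun _ : Fin m => ℝ)).comp continuous_snd))
  have h1 : ∀ᵐ A : Fin m → Fin m → ℝ, ∀ᵐ ξ : EuclideanSpace ℝ (Fin m),
      ¬ (Matrix.toEuclideanLin (Matrix.of A) ξ ∈ S ∧ ξ ∈ T) := by
    filter_upwards [Matrix.ae_det_ne_zero m] with A hA using h _ hA
  have hmeas : MeasurableSet {p : (Fin m → Fin m → ℝ) × EuclideanSpace ℝ (Fin m) |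
      ¬ (Matrix.toEuclideanLin (Matrix.of p.1) p.2 ∈ S ∧ p.2 ∈ T)} :=
    ((hcont.measurable hS).inter (measurable_snd hT)).compl
  -- Fubini: from now on `ξ` is fixed and `A` varies.
  have h2 := (Measure.ae_ae_comm hmeas).1 h1
  by_contra! hcon
  refine hcon.2 ?_
  filter_upwards [h2, Measure.ae_ne volume 0] with ξ hξ hξ0 hξT
  refine hcon.1 ?_
  let ℓ : (Fin m → Fin m → ℝ) →ₗ[ℝ] EuclideanSpace ℝ (Fin m) :=
    { toFun := fun A => Matrix.toEuclideanLin (Matrix.of A) ξ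
      map_add' := fun A B => by
        rw [← Matrix.of_add_of, map_add, LinearMap.add_apply]
      map_smul' := fun c A => by
        rw [← Matrix.smul_of, map_smul, LinearMap.smul_apply, RingHom.id_apply] }
  have hℓ : Function.Surjective ℓ := fun y => by
    obtain ⟨A, hA⟩ := Matrix.surjective_mulVec (m := Fin m) (ξ := ξ.ofLp)
      (fun h0 => hξ0 (by ext i; exact congrFun h0 i)) y.ofLp
    refine ⟨A, ?_⟩
    change WithLp.toLp 2 ((Matrix.of A).mulVec ξ.ofLp) = y
    rw [show (Matrix.of A).mulVec ξ.ofLp = y.ofLp from hA]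
  -- Under a surjective linear map, a measurable set has full measure exactly when its preimage
  -- does. A single nonzero `ξ ∈ T` satisfying `hξ` therefore makes `S` null.
  refine (ae_comp_linearMap_mem_iff ℓ volume volume hℓ hS.compl).1 ?_
  filter_upwards [hξ] with A hA hAS
  exact hA ⟨hAS, hξT⟩

/-! ### Orthogonality to an affine orbit, complex scalars -/

namespace AffRep

/-- `dual` inverts and transposes, and `pull` inverts again; starting from `Aᵀ` thus yields every
invertible `A` on the Fourier side. -/
theorem pull_dual_mk {m : ℕ} (A : Matrix (Fin m) (Fin m) ℝ) (hA : A.det ≠ 0)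
    (t ξ : EuclideanSpace ℝ (Fin m)) :
    pull (dual (Aff.mk (Matrix.GeneralLinearGroup.mkOfDetNeZero A.transpose
      (by rwa [Matrix.det_transpose])) t)) ξ = Matrix.toEuclideanLin A ξ := by
  rw [pull_dual]
  change Matrix.toEuclideanLin A.transpose.transpose ξ = _
  rw [Matrix.transpose_transpose]

/-- The pairing with frequency `t` is the Fourier transform at `-t` of the pointwise inner product,
which is integrable because both factors are in `L²`. -/
theorem ae_eq_zero_or_of_inner_modulation {m : ℕ}
    {ψ χ : Lp ℂ 2 (volume : Measure (EuclideanSpace ℝ (Fin m)))}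
    (H : ∀ t, inner ℂ (modulation t ψ) χ = 0) : ∀ᵐ ξ, ψ ξ = 0 ∨ χ ξ = 0 := by
  have h0 := Integrable.ae_eq_zero_of_fourier_eq_zero (L2.integrable_inner (𝕜 := ℂ) ψ χ)
    fun w => by
      have h1 := H (-w)
      rw [L2.inner_def] at h1
      rw [Real.fourier_eq, ← h1]
      refine integral_congr_ae ?_
      filter_upwards [coeFn_modulation (-w) ψ] with ξ h2
      rw [h2, ← smul_eq_mul, inner_smul_left, Circle.smul_def, smul_eq_mul,
        ← Circle.coe_inv_eq_conj, ← AddChar.map_neg_eq_inv, inner_neg_left, real_inner_comm,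
        neg_neg]
  filter_upwards [h0] with ξ h1
  rw [RCLike.inner_apply, mul_eq_zero] at h1
  simpa [or_comm] using h1

/-- If all the affine translates of `φ ∈ L²(ℝ^m; ℂ)` are orthogonal to `h`, then `φ` or `h` is
zero. -/
theorem eq_zero_or_eq_zero_of_inner_op_complex {m : ℕ} (hm : 1 ≤ m)
    {φ h : Lp ℂ 2 (volume : Measure (EuclideanSpace ℝ (Fin m)))}
    (H : ∀ g : Aff m, inner ℂ (op (1 : ℂ ≃ₗᵢ[ℂ] ℂ) g φ) h = 0) : φ = 0 ∨ h = 0 := by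
  set F := Lp.fourierTransformₗᵢ (EuclideanSpace ℝ (Fin m)) ℂ with hF
  have key : ∀ L : GL (Fin m) ℝ, ∀ᵐ ξ, op (1 : ℂ ≃ₗᵢ[ℂ] ℂ) (dual (Aff.mk L 0)) (F φ) ξ = 0 ∨
      F h ξ = 0 := fun L => ae_eq_zero_or_of_inner_modulation fun t => by
    -- `dual` forgets the translation part, so for fixed `L` only the modulation depends on `t`.
    have h1 : F (op (1 : ℂ ≃ₗᵢ[ℂ] ℂ) (Aff.mk L t) φ) =
        modulation t (op (1 : ℂ ≃ₗᵢ[ℂ] ℂ) (dual (Aff.mk L 0)) (F φ)) := fourier_op _ φ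
    rw [← h1, F.inner_map_map]
    exact H _
  have h1 := ae_notMem_or_ae_notMem_of_forall_det_ne_zero hm (S := {ξ | F φ ξ ≠ 0})
    (T := {ξ | F h ξ ≠ 0})
    ((measurableSet_singleton 0).compl.preimage (Lp.stronglyMeasurable _).measurable)
    ((measurableSet_singleton 0).compl.preimage (Lp.stronglyMeasurable _).measurable)
    fun A hA => by
      let L := Matrix.GeneralLinearGroup.mkOfDetNeZero A.transpose
        (by rwa [Matrix.det_transpose])
      filter_upwards [key L, coeFn_op (1 : ℂ ≃ₗᵢ[ℂ] ℂ) (dual (Aff.mk L 0)) (F φ)] with ξ h1 h2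
      rintro ⟨h3, h4⟩
      refine h3 ?_
      have h5 := h1.resolve_right h4
      rw [h2, twist, smul_eq_zero] at h5
      -- The determinant factor is nonzero, so it does not affect the support.
      have h6 := h5.resolve_left (RCLike.ofReal_ne_zero.2
        (Real.rpow_pos_of_pos (abs_pos.2 (det_ne_zero _)) _).ne')
      rw [← pull_dual_mk A hA 0 ξ]
      exact h6
  have h2 : ∀ f : Lp ℂ 2 (volume : Measure (EuclideanSpace ℝ (Fin m))),
      (∀ᵐ ξ, ξ ∉ {ξ | F f ξ ≠ 0}) → f = 0 := fun f hf => by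
    rw [← F.map_eq_zero_iff]
    refine Lp.ext ?_
    filter_upwards [hf, Lp.coeFn_zero ℂ 2 (volume : Measure (EuclideanSpace ℝ (Fin m)))]
      with ξ h3 h4
    rw [h4]
    simpa using h3
  exact h1.imp (h2 φ) (h2 h)

end AffRep

/-! ### Transfer to general scalars -/

/-- With the next three lemmas, this makes `RCLike.map 𝕜 ℂ` an embedding that respects products,
conjugation and real factors, hence the `L²` pairing and the affine action. -/
theorem RCLike.map_complex_mul {𝕜 : Type*} [RCLike 𝕜] (a b : 𝕜) :
    RCLike.map 𝕜 ℂ (a * b) = RCLike.map 𝕜 ℂ a * RCLike.map 𝕜 ℂ b := by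
  apply Complex.ext <;> simp

theorem RCLike.map_complex_conj {𝕜 : Type*} [RCLike 𝕜] (a : 𝕜) :
    RCLike.map 𝕜 ℂ (starRingEnd 𝕜 a) = starRingEnd ℂ (RCLike.map 𝕜 ℂ a) := by
  apply Complex.ext <;> simp

theorem RCLike.map_complex_ofReal {𝕜 : Type*} [RCLike 𝕜] (r : ℝ) :
    RCLike.map 𝕜 ℂ (r : 𝕜) = r := by
  apply Complex.ext <;> simp

theorem RCLike.map_complex_injective {𝕜 : Type*} [RCLike 𝕜] :
    Function.Injective (RCLike.map 𝕜 ℂ) := fun a b h => by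
  have h1 := congrArg Complex.re h
  have h2 := congrArg Complex.im h
  apply RCLike.ext
  · simpa using h1
  · simpa using h2

namespace AffRep

/-- If all the affine translates of `φ ∈ L²(ℝ^m; 𝕜)` are orthogonal to `h`, then `φ` or `h` is
zero. -/
theorem eq_zero_or_eq_zero_of_inner_op {𝕜 : Type*} [RCLike 𝕜] {m : ℕ} (hm : 1 ≤ m)
    {φ h : Lp 𝕜 2 (volume : Measure (EuclideanSpace ℝ (Fin m)))}
    (H : ∀ g : Aff m, inner 𝕜 (op (1 : 𝕜 ≃ₗᵢ[𝕜] 𝕜) g φ) h = 0) : φ = 0 ∨ h = 0 := by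
  have hz : ∀ f : Lp 𝕜 2 (volume : Measure (EuclideanSpace ℝ (Fin m))),
      (RCLike.map 𝕜 ℂ).compLp f = 0 → f = 0 := fun f hf => by
    refine Lp.ext ?_
    filter_upwards [(RCLike.map 𝕜 ℂ).coeFn_compLp f,
      Lp.coeFn_zero 𝕜 2 (volume : Measure (EuclideanSpace ℝ (Fin m))),
      Lp.coeFn_zero ℂ 2 (volume : Measure (EuclideanSpace ℝ (Fin m)))] with x h1 h2 h3
    rw [hf, h3] at h1
    rw [h2]
    refine RCLike.map_complex_injective ?_
    rw [← h1]
    exact (map_zero (RCLike.map 𝕜 ℂ)).symm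
  refine (eq_zero_or_eq_zero_of_inner_op_complex hm (φ := (RCLike.map 𝕜 ℂ).compLp φ)
    (h := (RCLike.map 𝕜 ℂ).compLp h) fun g => ?_).imp (hz φ) (hz h)
  -- The hypothesis, pushed through the embedding and under the integral, becomes the complex
  -- pairing of the embedded functions.
  have h1 := congrArg (RCLike.map 𝕜 ℂ) (H g)
  rw [L2.inner_def, ← ContinuousLinearMap.integral_comp_comm _ (L2.integrable_inner _ _),
    map_zero] at h1
  rw [L2.inner_def, ← h1]
  refine integral_congr_ae ?_
  filter_upwards [coeFn_op (1 : 𝕜 ≃ₗᵢ[𝕜] 𝕜) g φ,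
    coeFn_op (1 : ℂ ≃ₗᵢ[ℂ] ℂ) g ((RCLike.map 𝕜 ℂ).compLp φ),
    twist_ae_congr (1 : ℂ ≃ₗᵢ[ℂ] ℂ) g ((RCLike.map 𝕜 ℂ).coeFn_compLp' φ),
    (RCLike.map 𝕜 ℂ).coeFn_compLp h] with x h2 h3 h4 h5
  rw [h3, h4, h5, h2, RCLike.inner_apply, RCLike.inner_apply, RCLike.map_complex_mul,
    RCLike.map_complex_conj]
  simp only [twist, LinearIsometryEquiv.coe_one, id, smul_eq_mul, RCLike.map_complex_mul,
    RCLike.map_complex_ofReal]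
  rfl

end AffRep

/-! ### Vector-valued `L²` as a tensor product -/

namespace MeasureTheory.Lp

variable {𝕜 : Type*} [RCLike 𝕜] {α : Type*} [MeasurableSpace α] {μ : Measure α}
  {Y : Type*} [NormedAddCommGroup Y] [InnerProductSpace 𝕜 Y]

/-- The bilinear map that sends `y` and `f` to the function `x ↦ f x • y`. -/
noncomputable def smulConst (μ : Measure α) : Y →ₗ[𝕜] Lp 𝕜 2 μ →ₗ[𝕜] Lp Y 2 μ :=
  ContinuousLinearMap.compLpₗ₂ 2 μ (ContinuousLinearMap.lsmul 𝕜 𝕜 (E := Y)).flip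

theorem coeFn_smulConst (y : Y) (f : Lp 𝕜 2 μ) : smulConst μ y f =ᵐ[μ] fun x => f x • y :=
  ((ContinuousLinearMap.lsmul 𝕜 𝕜 (E := Y)).flip y).coeFn_compLp f

theorem inner_smulConst_smulConst (x y : Y) (f g : Lp 𝕜 2 μ) :
    inner 𝕜 (smulConst μ x f) (smulConst μ y g) = inner 𝕜 x y * inner 𝕜 f g := by
  rw [L2.inner_def, L2.inner_def, ← integral_const_mul]
  refine integral_congr_ae ?_
  filter_upwards [coeFn_smulConst x f, coeFn_smulConst y g] with a h1 h2
  rw [h1, h2, inner_smul_left, inner_smul_right, RCLike.inner_apply]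
  ring

variable {ι : Type*} [Fintype ι]

/-- The `i`-th component of an `L²` function with values in `𝕜^ι`. -/
noncomputable def component (i : ι) (f : Lp (EuclideanSpace 𝕜 ι) 2 μ) : Lp 𝕜 2 μ :=
  (EuclideanSpace.proj i : EuclideanSpace 𝕜 ι →L[𝕜] 𝕜).compLp f

theorem coeFn_component (i : ι) (f : Lp (EuclideanSpace 𝕜 ι) 2 μ) :
    component i f =ᵐ[μ] fun x => f x i :=
  (EuclideanSpace.proj i : EuclideanSpace 𝕜 ι →L[𝕜] 𝕜).coeFn_compLp f

/-- The inclusion of the algebraic tensor product into the Hilbert space tensor product. -/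
noncomputable def toTensorCompletion (𝕜 : Type*) [RCLike 𝕜] (ι : Type*) [Fintype ι]
    (μ : Measure α) : EuclideanSpace 𝕜 ι ⊗[𝕜] Lp 𝕜 2 μ →ₗ[𝕜]
      HilbertTensor 𝕜 (EuclideanSpace 𝕜 ι) (Lp 𝕜 2 μ) :=
  UniformSpace.Completion.toComplₗᵢ.toLinearMap

theorem toTensorCompletion_apply (a : EuclideanSpace 𝕜 ι ⊗[𝕜] Lp 𝕜 2 μ) :
    toTensorCompletion 𝕜 ι μ a = (a : HilbertTensor 𝕜 (EuclideanSpace 𝕜 ι) (Lp 𝕜 2 μ)) :=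
  rfl

theorem denseRange_toTensorCompletion : DenseRange (toTensorCompletion 𝕜 ι μ) :=
  UniformSpace.Completion.denseRange_coe

variable [DecidableEq ι]

/-- Turns orthogonality in `L²(μ; 𝕜^ι)` into orthogonality of scalar functions. -/
theorem inner_smulConst_single (i : ι) (f : Lp 𝕜 2 μ) (h : Lp (EuclideanSpace 𝕜 ι) 2 μ) :
    inner 𝕜 (smulConst μ (EuclideanSpace.single i (1 : 𝕜)) f) h = inner 𝕜 f (component i h) := by
  rw [L2.inner_def, L2.inner_def]
  refine integral_congr_ae ?_
  filter_upwards [coeFn_smulConst (EuclideanSpace.single i (1 : 𝕜)) f, coeFn_component i h]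
    with a h1 h2
  rw [h1, h2, inner_smul_left, EuclideanSpace.inner_single_left, RCLike.inner_apply]
  simp [mul_comm]

theorem sum_smulConst_component (f : Lp (EuclideanSpace 𝕜 ι) 2 μ) :
    ∑ i, smulConst μ (EuclideanSpace.single i (1 : 𝕜)) (component i f) = f := by
  refine Lp.ext ?_
  have h1 : ∀ᵐ x ∂μ, ∀ i, component i f x = f x i :=
    ae_all_iff.2 fun i => coeFn_component i f
  have h2 : ∀ᵐ x ∂μ, ∀ i, smulConst μ (EuclideanSpace.single i (1 : 𝕜)) (component i f) x =
      component i f x • EuclideanSpace.single i (1 : 𝕜) :=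
    ae_all_iff.2 fun i => coeFn_smulConst _ _
  filter_upwards [h1, h2, Lp.coeFn_finsetSum Finset.univ fun i =>
    smulConst μ (EuclideanSpace.single i (1 : 𝕜)) (component i f)] with x h1 h2 h3
  rw [h3]
  simp only [Finset.sum_apply, h2, h1]
  ext j
  simp [Finset.sum_apply, Pi.single_apply]

theorem eq_zero_of_component_eq_zero {f : Lp (EuclideanSpace 𝕜 ι) 2 μ}
    (hf : ∀ i, component i f = 0) : f = 0 := by
  rw [← sum_smulConst_component f]
  simp [hf]

/-- The linear map from the algebraic tensor product to `L²` induced by `smulConst`. -/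
noncomputable def ofTensor (μ : Measure α) : Y ⊗[𝕜] Lp 𝕜 2 μ →ₗ[𝕜] Lp Y 2 μ :=
  TensorProduct.lift (smulConst μ)

theorem ofTensor_tmul (y : Y) (f : Lp 𝕜 2 μ) : ofTensor μ (y ⊗ₜ[𝕜] f) = smulConst μ y f :=
  TensorProduct.lift.tmul y f

theorem inner_ofTensor (a b : Y ⊗[𝕜] Lp 𝕜 2 μ) :
    inner 𝕜 (ofTensor μ a) (ofTensor μ b) = inner 𝕜 a b := by
  induction a with
  | zero => simp
  | add a₁ a₂ h₁ h₂ => rw [map_add, inner_add_left, inner_add_left, h₁, h₂]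
  | tmul x f =>
    induction b with
    | zero => simp
    | add b₁ b₂ h₁ h₂ => rw [map_add, inner_add_right, inner_add_right, h₁, h₂]
    | tmul y g =>
      rw [ofTensor_tmul, ofTensor_tmul, inner_smulConst_smulConst, TensorProduct.inner_tmul]

theorem norm_ofTensor (a : Y ⊗[𝕜] Lp 𝕜 2 μ) : ‖ofTensor μ a‖ = ‖a‖ :=
  ((ofTensor μ).isometryOfInner inner_ofTensor).norm_map a

theorem ofTensor_injective : Function.Injective (ofTensor μ : Y ⊗[𝕜] Lp 𝕜 2 μ → Lp Y 2 μ) :=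
  (injective_iff_map_eq_zero _).2 fun a ha => by
    rw [← norm_eq_zero, ← norm_ofTensor, ha, norm_zero]

/-- A finite basis of `𝕜^ι` lets finitely many elementary tensors represent any function, so no
limit is needed. -/
theorem ofTensor_surjective :
    Function.Surjective (ofTensor μ : EuclideanSpace 𝕜 ι ⊗[𝕜] Lp 𝕜 2 μ → _) := fun f =>
  ⟨∑ i, EuclideanSpace.single i (1 : 𝕜) ⊗ₜ[𝕜] component i f, by
    rw [map_sum]
    simp only [ofTensor_tmul]
    exact sum_smulConst_component f⟩

/-- The algebraic tensor product `𝕜^ι ⊗ L²(μ; 𝕜)` as the space `L²(μ; 𝕜^ι)`. -/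
noncomputable def tensorEquiv (𝕜 : Type*) [RCLike 𝕜] (ι : Type*) [Fintype ι] [DecidableEq ι]
    (μ : Measure α) : EuclideanSpace 𝕜 ι ⊗[𝕜] Lp 𝕜 2 μ ≃ₗ[𝕜] Lp (EuclideanSpace 𝕜 ι) 2 μ :=
  LinearEquiv.ofBijective (ofTensor μ)
    ⟨ofTensor_injective, ofTensor_surjective⟩

/-- The unitary operator from the Hilbert space tensor product `𝕜^ι ⊗ L²(μ; 𝕜)` onto
`L²(μ; 𝕜^ι)` that sends `y ⊗ f` to `x ↦ f x • y`. -/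
noncomputable def hilbertTensorEquiv (𝕜 : Type*) [RCLike 𝕜] (ι : Type*) [Fintype ι]
    [DecidableEq ι] (μ : Measure α) :
    HilbertTensor 𝕜 (EuclideanSpace 𝕜 ι) (Lp 𝕜 2 μ) ≃ₗᵢ[𝕜] Lp (EuclideanSpace 𝕜 ι) 2 μ :=
  -- The source is dense in its completion. The target is already complete, hence the identity on
  -- that side.
  (tensorEquiv 𝕜 ι μ).extendOfIsometry
    (toTensorCompletion 𝕜 ι μ)
    LinearMap.id denseRange_toTensorCompletion Function.surjective_id.denseRange
    fun a => by
      rw [toTensorCompletion_apply, UniformSpace.Completion.norm_coe]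
      exact norm_ofTensor a

theorem hilbertTensorEquiv_coe (a : EuclideanSpace 𝕜 ι ⊗[𝕜] Lp 𝕜 2 μ) :
    hilbertTensorEquiv 𝕜 ι μ (a : HilbertTensor 𝕜 (EuclideanSpace 𝕜 ι) (Lp 𝕜 2 μ)) =
      ofTensor μ a := by
  rw [← toTensorCompletion_apply, hilbertTensorEquiv, LinearEquiv.extendOfIsometry_eq]
  rfl

end MeasureTheory.Lp

/-! ### The affine operators on tensors -/

namespace AffRep

variable {𝕜 : Type*} [RCLike 𝕜] {m : ℕ}
  {Y : Type*} [NormedAddCommGroup Y] [InnerProductSpace 𝕜 Y]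

theorem op_smulConst (u : Y ≃ₗᵢ[𝕜] Y) (g : Aff m) (y : Y)
    (f : Lp 𝕜 2 (volume : Measure (EuclideanSpace ℝ (Fin m)))) :
    op u g (Lp.smulConst volume y f) =
      Lp.smulConst volume (u y) (op (1 : 𝕜 ≃ₗᵢ[𝕜] 𝕜) g f) := by
  refine Lp.ext ?_
  filter_upwards [coeFn_op u g (Lp.smulConst volume y f),
    twist_ae_congr u g (Lp.coeFn_smulConst y f), coeFn_op (1 : 𝕜 ≃ₗᵢ[𝕜] 𝕜) g f,
    Lp.coeFn_smulConst (u y) (op (1 : 𝕜 ≃ₗᵢ[𝕜] 𝕜) g f)] with x h1 h2 h3 h4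
  rw [h1, h2, h4, h3]
  simp [twist, smul_smul]

/-- `congrIsometry` needs an invertible isometry while `op` is only bundled as an isometry, so `v`
stands for an invertible version of it. -/
theorem op_ofTensor (u : Y ≃ₗᵢ[𝕜] Y) (g : Aff m)
    (v : Lp 𝕜 2 (volume : Measure (EuclideanSpace ℝ (Fin m))) ≃ₗᵢ[𝕜]
      Lp 𝕜 2 (volume : Measure (EuclideanSpace ℝ (Fin m))))
    (hv : ∀ f, v f = op (1 : 𝕜 ≃ₗᵢ[𝕜] 𝕜) g f)
    (a : Y ⊗[𝕜] Lp 𝕜 2 (volume : Measure (EuclideanSpace ℝ (Fin m)))) :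
    op u g (Lp.ofTensor volume a) =
      Lp.ofTensor volume (TensorProduct.congrIsometry u v a) := by
  have h : (op u g).toLinearMap ∘ₗ Lp.ofTensor volume =
      Lp.ofTensor volume ∘ₗ (TensorProduct.congrIsometry u v).toLinearEquiv.toLinearMap :=
    TensorProduct.ext' fun y f => by
      change op u g (Lp.ofTensor volume (y ⊗ₜ[𝕜] f)) = Lp.ofTensor volume (u y ⊗ₜ[𝕜] v f)
      rw [Lp.ofTensor_tmul, Lp.ofTensor_tmul, op_smulConst, hv]
  exact LinearMap.congr_fun h a

theorem coeFn_op_one_right (u : Y ≃ₗᵢ[𝕜] Y)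
    (f : Lp Y 2 (volume : Measure (EuclideanSpace ℝ (Fin m)))) :
    op u 1 f =ᵐ[volume] fun x => u (f x) := by
  filter_upwards [coeFn_op u 1 f] with x h
  rw [h]
  simp [twist, pull_one]

end AffRep

/-! ### Reflections and swaps in the orthogonal group -/

/-- The reflection in the `i`-th coordinate. -/
noncomputable def coordReflection {m : ℕ} (i : Fin m) : Matrix.orthogonalGroup (Fin m) ℝ :=
  ⟨Matrix.diagonal fun k => if k = i then -1 else 1, by
    rw [Matrix.mem_orthogonalGroup_iff, Matrix.diagonal_transpose, Matrix.diagonal_mul_diagonal,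
      ← Matrix.diagonal_one]
    congr 1
    ext k
    split_ifs <;> simp⟩

/-- The exchange of the `i`-th and the `j`-th coordinate. -/
noncomputable def coordSwap {m : ℕ} (i j : Fin m) : Matrix.orthogonalGroup (Fin m) ℝ :=
  ⟨(Equiv.swap i j).permMatrix ℝ, by
    rw [Matrix.mem_orthogonalGroup_iff, Matrix.transpose_permMatrix, ← Matrix.permMatrix_mul]
    simp⟩

/-- Written as a difference to expose the projection onto the `i`-th axis as a combination of group
operators. -/
theorem stdOrthogonalRep_coordReflection {𝕜 : Type*} [RCLike 𝕜] {m : ℕ} (i : Fin m)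
    (y : EuclideanSpace 𝕜 (Fin m)) :
    (stdOrthogonalRep 𝕜 m).toHom (coordReflection i) y =
      y - (2 : 𝕜) • y i • EuclideanSpace.single i (1 : 𝕜) := by
  change WithLp.toLp 2 (((Matrix.diagonal fun k => if k = i then -1 else 1).map
    (algebraMap ℝ 𝕜)).mulVec y.ofLp) = _
  rw [Matrix.diagonal_map (map_zero _)]
  ext k
  by_cases hk : k = i
  · subst hk
    simp [Matrix.mulVec_diagonal]
    ring
  · simp [Matrix.mulVec_diagonal, hk]

theorem stdOrthogonalRep_coordSwap {𝕜 : Type*} [RCLike 𝕜] {m : ℕ} (i j : Fin m) :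
    (stdOrthogonalRep 𝕜 m).toHom (coordSwap i j) (EuclideanSpace.single i (1 : 𝕜)) =
      EuclideanSpace.single j (1 : 𝕜) := by
  change WithLp.toLp 2 ((((Equiv.swap i j).permMatrix ℝ).map (algebraMap ℝ 𝕜)).mulVec
    (EuclideanSpace.single i (1 : 𝕜)).ofLp) = _
  have h : ((Equiv.swap i j).permMatrix ℝ).map (algebraMap ℝ 𝕜) = (Equiv.swap i j).permMatrix 𝕜 := by
    ext k l
    simp [PEquiv.toMatrix_apply, apply_ite]
  rw [h, Matrix.permMatrix_mulVec]
  ext k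
  simp [Pi.single_apply, Equiv.swap_apply_eq_iff]

/-! ### Irreducibility and the intertwining property -/

section Irreducible

variable {𝕜 : Type*} [RCLike 𝕜] {m : ℕ}

theorem orthogonalAffineRep_toHom_apply (g : Matrix.orthogonalGroup (Fin m) ℝ × Aff m)
    (f : Lp (EuclideanSpace 𝕜 (Fin m)) 2 (volume : Measure (EuclideanSpace ℝ (Fin m)))) :
    (orthogonalAffineRep 𝕜 m).toHom g f =
      AffRep.op ((stdOrthogonalRep 𝕜 m).toHom g.1) g.2 f :=
  rfl

theorem orthogonalAffineRep_smulConst (g : Matrix.orthogonalGroup (Fin m) ℝ × Aff m)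
    (y : EuclideanSpace 𝕜 (Fin m)) (f : Lp 𝕜 2 (volume : Measure (EuclideanSpace ℝ (Fin m)))) :
    (orthogonalAffineRep 𝕜 m).toHom g (Lp.smulConst volume y f) =
      Lp.smulConst volume ((stdOrthogonalRep 𝕜 m).toHom g.1 y)
        (AffRep.op (1 : 𝕜 ≃ₗᵢ[𝕜] 𝕜) g.2 f) :=
  AffRep.op_smulConst _ _ _ _

theorem orthogonalAffineRep_coordReflection (i : Fin m)
    (f : Lp (EuclideanSpace 𝕜 (Fin m)) 2 (volume : Measure (EuclideanSpace ℝ (Fin m)))) :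
    (orthogonalAffineRep 𝕜 m).toHom (coordReflection i, 1) f =
      f - (2 : 𝕜) • Lp.smulConst volume (EuclideanSpace.single i (1 : 𝕜)) (Lp.component i f) := by
  rw [orthogonalAffineRep_toHom_apply]
  refine Lp.ext ?_
  set F := Lp.smulConst volume (EuclideanSpace.single i (1 : 𝕜)) (Lp.component i f) with hF
  filter_upwards [AffRep.coeFn_op_one_right ((stdOrthogonalRep 𝕜 m).toHom (coordReflection i)) f,
    Lp.coeFn_sub f ((2 : 𝕜) • F), Lp.coeFn_smul (2 : 𝕜) F,
    Lp.coeFn_smulConst (EuclideanSpace.single i (1 : 𝕜)) (Lp.component i f),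
    Lp.coeFn_component i f] with x h1 h2 h3 h4 h5
  rw [h1, h2, stdOrthogonalRep_coordReflection, Pi.sub_apply, h3, Pi.smul_apply, hF, h4, h5]

/-- An invariant subspace of `L²(ℝ^m; 𝕜^m)` contains, with `f`, all the functions
`x ↦ f x i • e_j`. -/
theorem smulConst_component_mem
    {M : Submodule 𝕜 (Lp (EuclideanSpace 𝕜 (Fin m)) 2
      (volume : Measure (EuclideanSpace ℝ (Fin m))))}
    (hM : ∀ g, ∀ ψ ∈ M, (orthogonalAffineRep 𝕜 m).toHom g ψ ∈ M)
    {f : Lp (EuclideanSpace 𝕜 (Fin m)) 2 (volume : Measure (EuclideanSpace ℝ (Fin m)))}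
    (hf : f ∈ M) (i j : Fin m) :
    Lp.smulConst volume (EuclideanSpace.single j (1 : 𝕜)) (Lp.component i f) ∈ M := by
  have h1 : Lp.smulConst volume (EuclideanSpace.single i (1 : 𝕜)) (Lp.component i f) ∈ M := by
    -- This difference is twice the wanted element.
    have h2 := M.sub_mem hf (hM (coordReflection i, 1) f hf)
    rw [orthogonalAffineRep_coordReflection, sub_sub_cancel] at h2
    exact (M.smul_mem_iff two_ne_zero).1 h2
  have h3 := hM (coordSwap i j, 1) _ h1
  rwa [orthogonalAffineRep_smulConst, stdOrthogonalRep_coordSwap,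
    AffRep.op_one] at h3

theorem nontrivial_Lp_two (hm : 1 ≤ m) :
    Nontrivial (Lp (EuclideanSpace 𝕜 (Fin m)) 2
      (volume : Measure (EuclideanSpace ℝ (Fin m)))) := by
  -- A unit vector times the indicator of the unit ball is a nonzero element.
  let y : EuclideanSpace 𝕜 (Fin m) := EuclideanSpace.single ⟨0, hm⟩ 1
  have hball : volume (Metric.ball (0 : EuclideanSpace ℝ (Fin m)) 1) ≠ ⊤ :=
    measure_ball_lt_top.ne
  refine ⟨indicatorConstLp 2 measurableSet_ball hball y, 0, ?_⟩
  rw [← norm_ne_zero_iff, norm_indicatorConstLp two_ne_zero ENNReal.ofNat_ne_top]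
  have h1 : 0 < volume.real (Metric.ball (0 : EuclideanSpace ℝ (Fin m)) 1) :=
    ENNReal.toReal_pos (Metric.measure_ball_pos volume 0 one_pos).ne' hball
  have h2 : ‖y‖ = 1 := by simp [y]
  rw [h2, one_mul]
  exact (Real.rpow_pos_of_pos h1 _).ne'

theorem isIrreducible_orthogonalAffineRep (hm : 1 ≤ m) :
    (orthogonalAffineRep 𝕜 m).IsIrreducible := by
  refine ⟨nontrivial_Lp_two hm, fun M hMc hM => ?_⟩
  -- Completeness of `M` guarantees that a proper `M` has a nonzero orthogonal vector.
  have : CompleteSpace M := hMc.completeSpace_coe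
  by_contra! hcon
  obtain ⟨f, hfM, hf⟩ := M.ne_bot_iff.1 hcon.1
  obtain ⟨h, hhM, hh⟩ := Mᗮ.ne_bot_iff.1 fun h0 => hcon.2 (M.orthogonal_eq_bot_iff.1 h0)
  obtain ⟨i, hi⟩ : ∃ i, Lp.component i f ≠ 0 := by
    by_contra! h0
    exact hf (Lp.eq_zero_of_component_eq_zero h0)
  refine hh (Lp.eq_zero_of_component_eq_zero fun j => ?_)
  refine (AffRep.eq_zero_or_eq_zero_of_inner_op hm (φ := Lp.component i f) fun g => ?_).resolve_left
    hi
  -- With trivial orthogonal part, `g` moves the scalar factor `f_i` and leaves `e_j` alone.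
  have h1 := hM (1, g) _ (smulConst_component_mem hM hfM i j)
  have h2 : (stdOrthogonalRep 𝕜 m).toHom 1 (EuclideanSpace.single j (1 : 𝕜)) =
      EuclideanSpace.single j 1 := by
    rw [map_one, LinearIsometryEquiv.coe_one, id]
  rw [orthogonalAffineRep_smulConst, h2] at h1
  rw [← Lp.inner_smulConst_single]
  exact M.inner_right_of_mem_orthogonal h1 hhM

/-- Both sides are continuous in `ψ`, and on the dense algebraic tensor product the identity is
`op_ofTensor`. -/
theorem intertwines_hilbertTensorEquiv :
    UnitaryRep.Intertwines (Lp.hilbertTensorEquiv 𝕜 (Fin m) volume)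
      ((stdOrthogonalRep 𝕜 m).outerTensor (affineRegularRep 𝕜 m))
      (orthogonalAffineRep 𝕜 m) := fun g ψ => by
  refine UniformSpace.Completion.induction_on ψ
    (isClosed_eq ((LinearIsometryEquiv.continuous _).comp (LinearIsometryEquiv.continuous _))
      ((LinearIsometryEquiv.continuous _).comp (LinearIsometryEquiv.continuous _))) fun a => ?_
  change Lp.hilbertTensorEquiv 𝕜 (Fin m) volume (HilbertTensor.map
    ((stdOrthogonalRep 𝕜 m).toHom g.1) ((affineRegularRep 𝕜 m).toHom g.2) a) = _
  rw [HilbertTensor.map_coe, Lp.hilbertTensorEquiv_coe, Lp.hilbertTensorEquiv_coe]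
  exact (AffRep.op_ofTensor _ _ _ (fun _ => rfl) a).symm

end Irreducible

end

/-- For `𝕜 = ℝ` or `ℂ` and `m ≥ 1`, the unitary representation
`((Q, L, t) • f) (x) = |det L|^(-1/2) Q f (L⁻¹ (x - t))` of `O(m) × Aff(m)` on `L²(ℝ^m; 𝕜^m)` is
irreducible, and the unitary operator `y ⊗ f ↦ (x ↦ f(x) y)` identifies it with the outer tensor
product of the standard representation of `O(m)` and the regular representation of `Aff(m)`. -/
theorem mainTheorem7 {𝕜 : Type*} [RCLike 𝕜] (m : ℕ) (hm : 1 ≤ m) :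
    (orthogonalAffineRep 𝕜 m).IsIrreducible ∧
    ∃ U : HilbertTensor 𝕜 (EuclideanSpace 𝕜 (Fin m))
          (Lp 𝕜 2 (volume : Measure (EuclideanSpace ℝ (Fin m)))) ≃ₗᵢ[𝕜]
        Lp (EuclideanSpace 𝕜 (Fin m)) 2 (volume : Measure (EuclideanSpace ℝ (Fin m))),
      (∀ (y : EuclideanSpace 𝕜 (Fin m))
          (f : Lp 𝕜 2 (volume : Measure (EuclideanSpace ℝ (Fin m)))),
        U (HilbertTensor.tmul y f) =ᵐ[volume] fun x => f x • y) ∧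
      UnitaryRep.Intertwines U
        ((stdOrthogonalRep 𝕜 m).outerTensor (affineRegularRep 𝕜 m))
        (orthogonalAffineRep 𝕜 m) := by
  refine ⟨isIrreducible_orthogonalAffineRep hm, Lp.hilbertTensorEquiv 𝕜 (Fin m) volume,
    fun y f => ?_, intertwines_hilbertTensorEquiv⟩
  rw [HilbertTensor.tmul, Lp.hilbertTensorEquiv_coe, Lp.ofTensor_tmul]
  exact Lp.coeFn_smulConst y f
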